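/- Let $[n]=\{1,\dots,n\}$, let $U$ be the uniform distribution on $[n]$, and let $d_{TV}(P,Q)=\frac12\sum_{i\in[n]}|P(i)-Q(i)|$. For every constant $c>0$ there is a constant $C>0$, depending only on $c$, such that for all integers $n\ge 1$, $k\ge 2$ and all $\varepsilon\in(0,1]$ there are $s_1,s_2\in\mathbb{N}$ and a (possibly randomized) algorithm, depending only on $n,k,\varepsilon$ (and $c$), with the following properties. Given $s_1$ samples from a distribution $P$ on $[n]$ and $s_2$ samples from each of $k$ distributions $D_1,\dots,D_k$ on $[n]$, all samples being independent, it outputs a subset of $\{1,\dots,k\}$. (1) Correctness: for every distribution $P$ on $[n]$ with $d_{TV}(P,U)\ge\varepsilon$ and every set $\chi\subseteq\{1,\dots,k\}$, if $D_i=P$ for $i\in\chi$ and $D_i=U$ for $i\notin\chi$, then the output equals $\chi$ with probability at least $8/9$, i.e. all $k$ distributions are simultaneously classified correctly as $P$ or $U$. The algorithm knows neither $P$ nor $\chi$. (2) Sample complexity: the total number of samples $s_1+k s_2$ satisfies $$s_1+k s_2\;\le\;\begin{cases} C\,\dfrac{\sqrt{nk\log k}}{\varepsilon^2} & \text{if }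 n\ge c\,k\log k,\\[2ex] C\,\dfrac{k\log k}{\varepsilon^2} & \text{if } n\le c\,k\log k.\end{cases}$$ -/

import Mathlib

open MeasureTheory
open scoped ENNReal

noncomputable section

/-- Total variation distance `(1/2) ∑ᵢ |P i - Q i|` of two distributions on `[n]`
(modelled as `Fin n`). -/
def tvDist {n : ℕ} (P Q : PMF (Fin n)) : ℝ :=
  (1 / 2) * ∑ i, |(P i).toReal - (Q i).toReal|

/-- The uniform distribution on `[n]`, `n ≥ 1`. -/
def unif (n : ℕ) [NeZero n] : PMF (Fin n) :=
  PMF.uniformOfFintype (Fin n)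

/-- The `k` distributions determined by a hidden set `χ ⊆ [k]`: `D i = P` for `i ∈ χ`, and
`D i` is uniform for `i ∉ χ`. -/
def instanceDist {n k : ℕ} [NeZero n] (P : PMF (Fin n)) (χ : Finset (Fin k)) :
    Fin k → PMF (Fin n) :=
  fun i => if i ∈ χ then P else unif n

/-- A sampling algorithm for classifying `k` distributions over `[n]`, given sample access to them
and to one further distribution `P`.  It draws `s₁` samples from `P` and `s₂` samples from each of
the `k` distributions, and from these data alone (and internal randomness) it outputs a subset of
`[k]`: the indices that it classifies as `P`, all others being classified as uniform. -/
structure Classifier (n k : ℕ) where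
  /-- number of samples drawn from `P` -/
  s₁ : ℕ
  /-- number of samples drawn from each of the `k` distributions -/
  s₂ : ℕ
  /-- the law of the output, given the observed samples -/
  output : (Fin s₁ → Fin n) × (Fin k → Fin s₂ → Fin n) → PMF (Finset (Fin k))

namespace Classifier

variable {n k : ℕ}

/-- Total number of samples drawn. -/
def samples (A : Classifier n k) : ℕ := A.s₁ + k * A.s₂

/-- Joint law of the samples: all of them are independent, `s₁` of them drawn from `P` and `s₂`
drawn from each `D i`. -/
def dataLaw (A : Classifier n k) (P : PMF (Fin n)) (D : Fin k → PMF (Fin n)) :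
    Measure ((Fin A.s₁ → Fin n) × (Fin k → Fin A.s₂ → Fin n)) :=
  (Measure.pi fun _ : Fin A.s₁ => P.toMeasure).prod
    (Measure.pi fun i : Fin k => Measure.pi fun _ : Fin A.s₂ => (D i).toMeasure)

/-- The probability, over the samples and the internal randomness, that the algorithm outputs
exactly the hidden set `χ`. -/
def successProb [NeZero n] (A : Classifier n k) (P : PMF (Fin n)) (χ : Finset (Fin k)) : ℝ≥0∞ :=
  ∫⁻ x, A.output x χ ∂(A.dataLaw P (instanceDist P χ))

end Classifier

end

/-! The samples from `P` are spent on a function `f` on `[n]` whose mean under `P` exceeds its mean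
under `U` by several standard deviations; each `D i` then needs only a test of the mean of `f`, with
a threshold computed from `f` and `U` alone.

One batch of `s` samples from `P` gives weights `w i = 1 / (τ + freq i)` with `τ = max (1/n) (1/s)`;
an independent batch gives `f i = w i * (freq i - 1/n)`. Given the weights, the mean gap of `f` has
expectation `S = ∑ w i (p i - 1/n)²`, and Cauchy–Schwarz forces `n τ S ≥ 2 ε²`. Dividing by the
estimated frequency keeps the second moments of `f` under `P` and `U` of order `S + 1 / (n s τ²)`,
even if `P` has heavy atoms (`invFreq_good`, `testFun_good`). Hence `m` samples separate the means
once `m ε² ≳ 1` and `m s ε⁴ ≳ n` (`separates_good`).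

For each `D i`, Chebyshev makes one batch of `m` samples err with probability at most `1/9`. A
majority over `t = O(log k)` batches errs with probability at most `(2/3)^t`, and a union bound
covers all `k` distributions.

The cost `2 s + k t m` is balanced, with `L = k log k` and `M = max n (c L)`, by `s ≈ √(M L) / ε²`
and `m ≈ √(M / L) / ε²`. The two values of `M` are the two regimes. -/

/-! ### Finite expectations over i.i.d. samples; occurrence counts. -/

section IidExpect

variable {α : Type*} [Fintype α]

/-- Expectation of `F` over `s` independent draws from the weights `p`. -/
def iidExpect (p : α → ℝ) (s : ℕ) (F : (Fin s → α) → ℝ) : ℝ :=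
  ∑ x, (∏ j, p (x j)) * F x

theorem iidExpect_add (p : α → ℝ) (s : ℕ) (F G : (Fin s → α) → ℝ) :
    iidExpect p s (fun x => F x + G x) = iidExpect p s F + iidExpect p s G := by
  simp only [iidExpect, mul_add, Finset.sum_add_distrib]

theorem iidExpect_const_mul (p : α → ℝ) (s : ℕ) (c : ℝ) (F : (Fin s → α) → ℝ) :
    iidExpect p s (fun x => c * F x) = c * iidExpect p s F := by
  simp only [iidExpect, Finset.mul_sum]
  exact Finset.sum_congr rfl fun x _ => by ring

theorem iidExpect_sum {ι : Type*} (I : Finset ι) (p : α → ℝ) (s : ℕ)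
    (F : ι → (Fin s → α) → ℝ) :
    iidExpect p s (fun x => ∑ i ∈ I, F i x) = ∑ i ∈ I, iidExpect p s (F i) := by
  simp only [iidExpect, Finset.mul_sum]
  exact Finset.sum_comm

theorem iidExpect_mono {p : α → ℝ} (hp : ∀ a, 0 ≤ p a) {s : ℕ} {F G : (Fin s → α) → ℝ}
    (h : ∀ x, F x ≤ G x) : iidExpect p s F ≤ iidExpect p s G :=
  Finset.sum_le_sum fun x _ =>
    mul_le_mul_of_nonneg_left (h x) (Finset.prod_nonneg fun _ _ => hp _)

theorem iidExpect_nonneg {p : α → ℝ} (hp : ∀ a, 0 ≤ p a) {s : ℕ} {F : (Fin s → α) → ℝ}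
    (h : ∀ x, 0 ≤ F x) : 0 ≤ iidExpect p s F :=
  Finset.sum_nonneg fun x _ => mul_nonneg (Finset.prod_nonneg fun _ _ => hp _) (h x)

theorem iidExpect_zero (p : α → ℝ) (F : (Fin 0 → α) → ℝ) :
    iidExpect p 0 F = F Fin.elim0 := by
  simp only [iidExpect, Finset.univ_eq_empty, Finset.prod_empty, one_mul]
  rw [Fintype.sum_unique]
  exact congrArg F (Subsingleton.elim _ _)

theorem iidExpect_succ (p : α → ℝ) (s : ℕ) (F : (Fin (s + 1) → α) → ℝ) :
    iidExpect p (s + 1) F = ∑ a, p a * iidExpect p s (fun x => F (Fin.cons a x)) := by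
  simp only [iidExpect, Finset.mul_sum]
  rw [← Fintype.sum_prod_type', ← (Fin.consEquiv fun _ : Fin (s + 1) => α).sum_comp]
  refine Finset.sum_congr rfl fun x _ => ?_
  simp [Fin.consEquiv, Fin.prod_univ_succ, mul_assoc]

theorem iidExpect_const {p : α → ℝ} (hp1 : ∑ a, p a = 1) (s : ℕ) (c : ℝ) :
    iidExpect p s (fun _ => c) = c := by
  induction s with
  | zero => simp [iidExpect_zero]
  | succ s ih => rw [iidExpect_succ]; simp [ih, ← Finset.sum_mul, hp1]

/-- Markov's inequality at level `1`. -/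
theorem iidExpect_indicator_le {p : α → ℝ} (hp : ∀ a, 0 ≤ p a) {s : ℕ}
    {F : (Fin s → α) → ℝ} (h0 : ∀ x, 0 ≤ F x) (A : Set (Fin s → α))
    (h1 : ∀ x ∈ A, 1 ≤ F x) :
    iidExpect p s (A.indicator 1) ≤ iidExpect p s F := by
  refine iidExpect_mono hp fun x => ?_
  by_cases hx : x ∈ A
  · simpa [hx] using h1 x hx
  · simpa [hx] using h0 x

/-- First moment of a sum over the sample. -/
theorem iidExpect_sample_sum {p : α → ℝ} (hp1 : ∑ a, p a = 1) (g : α → ℝ) (s : ℕ) :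
    iidExpect p s (fun x => ∑ j, g (x j)) = s * ∑ a, p a * g a := by
  induction s with
  | zero => simp [iidExpect_zero]
  | succ s ih =>
    rw [iidExpect_succ]
    simp only [Fin.sum_univ_succ, Fin.cons_zero, Fin.cons_succ]
    simp only [iidExpect_add, ih, iidExpect_const hp1, mul_add, Finset.sum_add_distrib,
      ← Finset.sum_mul, hp1]
    push_cast; ring

/-- Second moment about `r` of a sum over the sample. -/
theorem iidExpect_sample_sum_sub_sq {p : α → ℝ} (hp1 : ∑ a, p a = 1) (g : α → ℝ) (s : ℕ)
    (r : ℝ) :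
    iidExpect p s (fun x => (∑ j, g (x j) - r) ^ 2) =
      s * (∑ a, p a * g a ^ 2 - (∑ a, p a * g a) ^ 2) + (s * ∑ a, p a * g a - r) ^ 2 := by
  induction s generalizing r with
  | zero => simp [iidExpect_zero]
  | succ s ih =>
    rw [iidExpect_succ]
    have h : ∀ a, iidExpect p s (fun x => (∑ j, g ((Fin.cons a x : Fin (s + 1) → α) j) - r) ^ 2) =
        iidExpect p s (fun x => (∑ j, g (x j) - (r - g a)) ^ 2) := fun a => by
      congr 1; funext x
      simp only [Fin.sum_univ_succ, Fin.cons_zero, Fin.cons_succ]; ring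
    simp only [h, ih]
    generalize hμ : ∑ a, p a * g a = μ
    generalize hv : ∑ a, p a * g a ^ 2 = v
    have : ∀ a, p a * (s * (v - μ ^ 2) + (s * μ - (r - g a)) ^ 2) =
        p a * (s * (v - μ ^ 2) + (s * μ - r) ^ 2) + 2 * (s * μ - r) * (p a * g a)
          + p a * g a ^ 2 := fun a => by ring
    simp only [this, Finset.sum_add_distrib, ← Finset.sum_mul, ← Finset.mul_sum, hp1, hμ, hv]
    push_cast; ring

/-- Chebyshev's second-moment bound for the empirical mean. -/
theorem iidExpect_mean_sub_sq_le {p : α → ℝ} (hp1 : ∑ a, p a = 1) (g : α → ℝ) {s : ℕ}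
    (hs : 0 < s) (r : ℝ) :
    iidExpect p s (fun x => ((∑ j, g (x j)) / s - r) ^ 2) ≤
      (∑ a, p a * g a ^ 2) / s + (∑ a, p a * g a - r) ^ 2 := by
  have hs' : (0 : ℝ) < s := by exact_mod_cast hs
  have h : (fun x : Fin s → α => ((∑ j, g (x j)) / s - r) ^ 2) =
      fun x => (1 / (s : ℝ) ^ 2) * (∑ j, g (x j) - s * r) ^ 2 := by
    funext x; field_simp
  rw [h, iidExpect_const_mul, iidExpect_sample_sum_sub_sq hp1]
  have : (1 / (s : ℝ) ^ 2) * (s * (∑ a, p a * g a ^ 2 - (∑ a, p a * g a) ^ 2)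
      + (s * ∑ a, p a * g a - s * r) ^ 2) = (∑ a, p a * g a ^ 2) / s + (∑ a, p a * g a - r) ^ 2
        - (∑ a, p a * g a) ^ 2 / s := by
    field_simp; ring
  rw [this]
  have : 0 ≤ (∑ a, p a * g a) ^ 2 / s := by positivity
  linarith

variable [DecidableEq α]

/-- Number of occurrences of `i` in the sample `x`. -/
def occ {s : ℕ} (i : α) (x : Fin s → α) : ℕ := ∑ j, if x j = i then 1 else 0

theorem iidExpect_occ_succ {p : α → ℝ} (hp1 : ∑ a, p a = 1) (i : α) (s : ℕ) (φ : ℕ → ℝ) :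
    iidExpect p (s + 1) (fun x => φ (occ i x)) =
      p i * iidExpect p s (fun x => φ (occ i x + 1)) +
        (1 - p i) * iidExpect p s (fun x => φ (occ i x)) := by
  rw [iidExpect_succ]
  have h : ∀ a, p a * iidExpect p s (fun x => φ (occ i (Fin.cons a x : Fin (s + 1) → α))) =
      (if a = i then p a * (iidExpect p s (fun x => φ (occ i x + 1))
        - iidExpect p s (fun x => φ (occ i x))) else 0)
        + p a * iidExpect p s (fun x => φ (occ i x)) := fun a => by
    simp only [occ, Fin.sum_univ_succ, Fin.cons_zero, Fin.cons_succ]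
    split_ifs with ha
    · simp only [add_comm 1]; ring
    · simp
  simp only [h, Finset.sum_add_distrib, ← Finset.sum_mul, hp1]
  rw [Finset.sum_ite_eq' Finset.univ i]
  simp only [Finset.mem_univ, if_true]
  ring

/-- Size-biasing identity for a binomial count. -/
theorem iidExpect_occ_mul {p : α → ℝ} (hp1 : ∑ a, p a = 1) (i : α) (s : ℕ) (ψ : ℕ → ℝ) :
    iidExpect p (s + 1) (fun x => occ i x * ψ (occ i x)) =
      (s + 1) * p i * iidExpect p s (fun x => ψ (occ i x + 1)) := by
  induction s generalizing ψ with
  | zero =>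
    rw [iidExpect_occ_succ hp1 i 0 fun b => b * ψ b]
    simp [iidExpect_zero, occ]
  | succ s ih =>
    rw [iidExpect_occ_succ hp1 i (s + 1) fun b => b * ψ b]
    have h : (fun x : Fin (s + 1) → α => ((occ i x + 1 : ℕ) : ℝ) * ψ (occ i x + 1)) =
        fun x => occ i x * ψ (occ i x + 1) + ψ (occ i x + 1) := by
      funext x; push_cast; ring
    rw [h, iidExpect_add, ih, ih fun b => ψ (b + 1),
      iidExpect_occ_succ hp1 i s fun b => ψ (b + 1)]
    push_cast; ring

/-- Size-biasing twice turns this inverse moment into the expectation of a function bounded by `1`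
over `s + 2` draws. It says that `1 / count²` is about `1 / (s p i)²` on average, with no
concentration needed. -/
theorem iidExpect_inv_occ_le {p : α → ℝ} (hp : ∀ a, 0 ≤ p a) (hp1 : ∑ a, p a = 1) (i : α)
    (s : ℕ) :
    (s + 1) * (s + 2) * p i ^ 2 *
      iidExpect p s (fun x => 1 / (((occ i x : ℝ) + 2) * (occ i x + 1))) ≤ 1 := by
  -- The uncancelled factor `b - 1` is deliberate: with `x / 0 = 0`, `b` times this function is `0`
  -- at `b = 0, 1` and `1` beyond, and after the shift it again has the form `b * ψ b`.
  have h1 := iidExpect_occ_mul hp1 i (s + 1) fun b => ((b : ℝ) - 1) / (b * (b - 1))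
  have h2 := iidExpect_occ_mul hp1 i s fun b => 1 / (((b : ℝ) + 1) * b)
  have h3 : iidExpect p (s + 1 + 1)
      (fun x => (occ i x : ℝ) * (((occ i x : ℝ) - 1) / (occ i x * (occ i x - 1)))) ≤ 1 := by
    refine (iidExpect_mono hp fun x => ?_).trans_eq (iidExpect_const hp1 _ 1)
    rw [← mul_div_assoc]; exact div_self_le_one _
  have h4 : (fun x : Fin (s + 1) → α => (((occ i x + 1 : ℕ) : ℝ) - 1) /
      ((occ i x + 1 : ℕ) * ((occ i x + 1 : ℕ) - 1))) =
      fun x => occ i x * (1 / (((occ i x : ℝ) + 1) * occ i x)) := by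
    funext x; push_cast; rw [add_sub_cancel_right, mul_one_div]
  have h5 : (fun x : Fin s → α => 1 / ((((occ i x + 1 : ℕ) : ℝ) + 1) * (occ i x + 1 : ℕ))) =
      fun x => 1 / (((occ i x : ℝ) + 2) * (occ i x + 1)) := by
    funext x; push_cast; ring_nf
  rw [h1, h4, h2, h5] at h3
  push_cast at h3
  linarith

end IidExpect

theorem cast_occ {α : Type*} [DecidableEq α] {s : ℕ} (i : α) (x : Fin s → α) :
    (occ i x : ℝ) = ∑ j, (if x j = i then (1 : ℝ) else 0) := by
  simp [occ]

/-! ### Markov's inequality for good events; moments of empirical frequencies. -/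

section Markov

variable {α : Type*} [Fintype α]

/-- Markov's inequality at level `1`, for the complementary event. -/
theorem one_sub_le_iidExpect_indicator {p : α → ℝ} (hp : ∀ a, 0 ≤ p a) (hp1 : ∑ a, p a = 1)
    {s : ℕ} {F : (Fin s → α) → ℝ} (h0 : ∀ x, 0 ≤ F x) (A : Set (Fin s → α))
    (h1 : ∀ x, F x < 1 → x ∈ A) :
    1 - iidExpect p s F ≤ iidExpect p s (A.indicator 1) := by
  have h : iidExpect p s (fun x => 1 + (-1) * F x) = 1 - iidExpect p s F := by
    rw [iidExpect_add, iidExpect_const_mul, iidExpect_const hp1]; ring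
  rw [← h]
  refine iidExpect_mono hp fun x => ?_
  by_cases hx : x ∈ A
  · simpa [hx] using h0 x
  · have := not_lt.1 (mt (h1 x) hx)
    simp only [hx, not_false_eq_true, Set.indicator_of_notMem]
    linarith

theorem sum_mul_occ [DecidableEq α] {s : ℕ} (g : α → ℝ) (x : Fin s → α) :
    ∑ i, g i * occ i x = ∑ j, g (x j) := by
  simp only [cast_occ, Finset.mul_sum]
  rw [Finset.sum_comm]
  simp

theorem iidExpect_occ [DecidableEq α] {p : α → ℝ} (hp1 : ∑ a, p a = 1) (i : α) (s : ℕ) :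
    iidExpect p s (fun x => (occ i x : ℝ)) = s * p i := by
  simp only [cast_occ]
  rw [iidExpect_sample_sum hp1 (fun a => if a = i then 1 else 0)]
  simp

theorem iidExpect_freq_sub_sq_le [DecidableEq α] {p : α → ℝ} (hp1 : ∑ a, p a = 1) (i : α)
    {s : ℕ} (hs : 0 < s) (r : ℝ) :
    iidExpect p s (fun x => ((occ i x : ℝ) / s - r) ^ 2) ≤ p i / s + (p i - r) ^ 2 := by
  simp only [cast_occ]
  have := iidExpect_mean_sub_sq_le hp1 (fun a => if a = i then 1 else 0) hs r
  simpa using this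

end Markov

/-! ### The test function and its separation property. -/

/-- The smoothing scale `max (1 / n) (1 / s)`. -/
noncomputable def smoothing (n s : ℕ) : ℝ := max (1 / (n : ℝ)) (1 / s)

/-- Inverse smoothed frequency. -/
noncomputable def invFreq {n s : ℕ} (x : Fin s → Fin n) (i : Fin n) : ℝ :=
  1 / (smoothing n s + occ i x / s)

/-- Test function for distinguishing `P` from uniform: the excess frequency in the sample `x`,
weighted by the inverse smoothed frequency in an independent sample `x'`. -/
noncomputable def testFun {n s : ℕ} (x' x : Fin s → Fin n) (i : Fin n) : ℝ :=
  invFreq x' i * (occ i x / s - 1 / n)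

theorem one_le_mul_smoothing' {n s : ℕ} (hs : 0 < s) : 1 ≤ s * smoothing n s := by
  have hs' : (0 : ℝ) < s := by exact_mod_cast hs
  calc (1 : ℝ) = s * (1 / s) := by field_simp
    _ ≤ _ := mul_le_mul_of_nonneg_left (le_max_right _ _) hs'.le

/-- Cauchy–Schwarz with weights `τ + q i`, of total mass `n τ + 1`. This converts the L¹ distance
into the weighted square sum, for any probability vector `q`: the true one or an empirical one. -/
theorem sum_abs_sq_le {n : ℕ} {τ : ℝ} (hτ : 0 < τ) {q : Fin n → ℝ} (hq : ∀ i, 0 ≤ q i)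
    (hq1 : ∑ i, q i = 1) (d : Fin n → ℝ) :
    (∑ i, |d i|) ^ 2 ≤ (∑ i, 1 / (τ + q i) * d i ^ 2) * (n * τ + 1) := by
  have h := Finset.sum_sq_le_sum_mul_sum_of_sq_le_mul Finset.univ (r := fun i => |d i|)
    (f := fun i => 1 / (τ + q i) * d i ^ 2) (g := fun i => τ + q i)
    (fun i _ => by have := hq i; positivity) (fun i _ => by have := hq i; positivity)
    (fun i _ => by
      have : τ + q i ≠ 0 := by have := hq i; positivity
      rw [sq_abs]; refine le_of_eq ?_; field_simp)
  simpa [Finset.sum_add_distrib, hq1] using h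

section Moments

variable {n : ℕ} [NeZero n]

theorem one_le_mul_smoothing (s : ℕ) : 1 ≤ n * smoothing n s := by
  have hn : (0 : ℝ) < n := by exact_mod_cast NeZero.pos n
  calc (1 : ℝ) = n * (1 / n) := by field_simp
    _ ≤ _ := mul_le_mul_of_nonneg_left (le_max_left _ _) hn.le

theorem smoothing_pos (s : ℕ) : 0 < smoothing n s := by
  have hn : (0 : ℝ) < n := by exact_mod_cast NeZero.pos n
  exact lt_max_of_lt_left (by positivity)

theorem invFreq_pos {s : ℕ} (x : Fin s → Fin n) (i : Fin n) : 0 < invFreq x i := by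
  have := smoothing_pos (n := n) s
  unfold invFreq; positivity

theorem invFreq_le {s : ℕ} (x : Fin s → Fin n) (i : Fin n) :
    invFreq x i ≤ 1 / smoothing n s := by
  have := smoothing_pos (n := n) s
  exact one_div_le_one_div_of_le this (le_add_of_nonneg_right (by positivity))

/-- The estimated weight is on average as good as the ideal `1 / (τ + p i)`. For `p i ≤ τ` the bound
`1 / τ` on the weight suffices; for `p i ≥ τ` the inverse moment of the count takes over, smoothing
acting as at least one extra count because `s τ ≥ 1`. -/
theorem mul_iidExpect_invFreq_sq_le {p : Fin n → ℝ} (hp : ∀ i, 0 ≤ p i) (hp1 : ∑ i, p i = 1)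
    {s : ℕ} (hs : 0 < s) (i : Fin n) :
    p i * iidExpect p s (fun x => invFreq x i ^ 2) ≤ 4 * (1 / (smoothing n s + p i)) := by
  set τ := smoothing n s with hτdef
  have hτ : 0 < τ := smoothing_pos s
  have hsτ : 1 ≤ s * τ := one_le_mul_smoothing' hs
  have hs' : (0 : ℝ) < s := by exact_mod_cast hs
  have hpi := hp i
  rw [mul_one_div, le_div_iff₀ (by positivity)]
  rcases le_total (p i) τ with h | h
  · have h1 : iidExpect p s (fun x => invFreq x i ^ 2) ≤ 1 / τ ^ 2 := by
      refine (iidExpect_mono hp fun x => ?_).trans_eq (iidExpect_const hp1 _ _)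
      rw [← one_div_pow]
      exact pow_le_pow_left₀ (invFreq_pos x i).le (invFreq_le x i) 2
    calc p i * iidExpect p s (fun x => invFreq x i ^ 2) * (τ + p i)
        ≤ τ * (1 / τ ^ 2) * (τ + τ) := by
          gcongr
          exact iidExpect_nonneg hp fun x => sq_nonneg _
      _ = 2 := by field_simp; norm_num
      _ ≤ 4 := by norm_num
  · have hpp : 0 < p i := hτ.trans_le h
    have h1 : iidExpect p s (fun x => invFreq x i ^ 2) ≤
        2 * s ^ 2 * iidExpect p s (fun x => 1 / (((occ i x : ℝ) + 2) * (occ i x + 1))) := by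
      rw [← iidExpect_const_mul]
      refine iidExpect_mono hp fun x => ?_
      have hN : (0 : ℝ) ≤ occ i x := Nat.cast_nonneg _
      have e : invFreq x i = s / (s * τ + occ i x) := by
        rw [invFreq, ← hτdef]; field_simp
      rw [e, div_pow, mul_one_div, div_le_div_iff₀ (by positivity) (by positivity)]
      have : ((occ i x : ℝ) + 2) * (occ i x + 1) ≤ 2 * (s * τ + occ i x) ^ 2 := by
        nlinarith
      calc (s : ℝ) ^ 2 * (((occ i x : ℝ) + 2) * (occ i x + 1))
          ≤ s ^ 2 * (2 * (s * τ + occ i x) ^ 2) := by gcongr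
        _ = _ := by ring
    have h2 := iidExpect_inv_occ_le hp hp1 i s
    set e := iidExpect p s (fun x => 1 / (((occ i x : ℝ) + 2) * (occ i x + 1)))
    have he : 0 ≤ e := iidExpect_nonneg hp fun x => by positivity
    have h3 : (s : ℝ) ^ 2 * p i ^ 2 * e ≤ 1 := by
      refine le_trans ?_ h2
      gcongr
      nlinarith
    calc p i * iidExpect p s (fun x => invFreq x i ^ 2) * (τ + p i)
        ≤ p i * (2 * s ^ 2 * e) * (p i + p i) := by gcongr
      _ = 4 * (s ^ 2 * p i ^ 2 * e) := by ring
      _ ≤ 4 := by linarith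

/-- With probability at least `35 / 36`, the second moment under `p` of the weighted deviations `d` is
at most a constant times their weighted square sum. -/
theorem invFreq_good {p : Fin n → ℝ} (hp : ∀ i, 0 ≤ p i) (hp1 : ∑ i, p i = 1) {s : ℕ}
    (hs : 0 < s) (d : Fin n → ℝ) (hd : 0 < ∑ i, |d i|) :
    35 / 36 ≤ iidExpect p s ({x | ∑ i, p i * invFreq x i ^ 2 * d i ^ 2 ≤
      20736 * ∑ i, invFreq x i * d i ^ 2}.indicator 1) := by
  set τ := smoothing n s with hτdef
  have hτ : 0 < τ := smoothing_pos s
  have hs' : (0 : ℝ) < s := by exact_mod_cast hs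
  set σ := ∑ i, 1 / (τ + p i) * d i ^ 2 with hσdef
  have hσ : 0 < σ := by
    have h := sum_abs_sq_le hτ hp hp1 d
    have h2 : 0 < (∑ i, |d i|) ^ 2 := by positivity
    exact pos_of_mul_pos_left (h2.trans_le h) (by positivity)
  -- `D` is the Cauchy–Schwarz partner of the weighted square sum: `σ² ≤ (∑ w d²) * D`, and `D` has
  -- mean `σ`. So an upper bound on `D` gives a lower bound on `∑ w d²`.
  let D : (Fin s → Fin n) → ℝ := fun x => ∑ i, d i ^ 2 / (τ + p i) ^ 2 * (τ + occ i x / s)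
  let R : (Fin s → Fin n) → ℝ := fun x => ∑ i, p i * invFreq x i ^ 2 * d i ^ 2
  have hD0 : ∀ x, 0 ≤ D x := fun x => Finset.sum_nonneg fun i _ => by positivity
  have hR0 : ∀ x, 0 ≤ R x := fun x => Finset.sum_nonneg fun i _ => by
    have := hp i; positivity
  have hD : iidExpect p s D = σ := by
    rw [iidExpect_sum]
    refine Finset.sum_congr rfl fun i _ => ?_
    have hpi := hp i
    rw [iidExpect_const_mul, iidExpect_add, iidExpect_const hp1]
    have : (fun x : Fin s → Fin n => (occ i x : ℝ) / s) = fun x => (1 / (s : ℝ)) * occ i x := by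
      funext x; ring
    rw [this, iidExpect_const_mul, iidExpect_occ hp1]
    field_simp
  have hR : iidExpect p s R ≤ 4 * σ := by
    rw [iidExpect_sum, hσdef, Finset.mul_sum]
    refine Finset.sum_le_sum fun i _ => ?_
    have : (fun x : Fin s → Fin n => p i * invFreq x i ^ 2 * d i ^ 2) =
        fun x => (p i * d i ^ 2) * invFreq x i ^ 2 := by funext x; ring
    rw [this, iidExpect_const_mul]
    calc p i * d i ^ 2 * iidExpect p s (fun x => invFreq x i ^ 2)
        = p i * iidExpect p s (fun x => invFreq x i ^ 2) * d i ^ 2 := by ring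
      _ ≤ 4 * (1 / (τ + p i)) * d i ^ 2 := by
        exact mul_le_mul_of_nonneg_right (mul_iidExpect_invFreq_sq_le hp hp1 hs i) (sq_nonneg _)
      _ = _ := by ring
  -- One Markov bound yields both `D ≤ 72 σ` and `R ≤ 288 σ`, each term costing `1/72`; then `20736
  -- = 72 * 288`.
  have key := one_sub_le_iidExpect_indicator hp hp1
    (F := fun x => 1 / (72 * σ) * D x + 1 / (288 * σ) * R x)
    (fun x => by have := hD0 x; have := hR0 x; positivity)
    {x | ∑ i, p i * invFreq x i ^ 2 * d i ^ 2 ≤ 20736 * ∑ i, invFreq x i * d i ^ 2}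
    (fun x hx => ?_)
  · refine le_trans ?_ key
    rw [iidExpect_add, iidExpect_const_mul, iidExpect_const_mul, hD]
    have h1 : 1 / (72 * σ) * σ = 1 / 72 := by field_simp
    have h2 : 1 / (288 * σ) * iidExpect p s R ≤ 1 / (288 * σ) * (4 * σ) := by gcongr
    have h3 : 1 / (288 * σ) * (4 * σ) = 1 / 72 := by field_simp; norm_num
    linarith
  · have hDx : D x ≤ 72 * σ := by
      have h1 : 1 / (72 * σ) * D x ≤ 1 := by
        have : 0 ≤ 1 / (288 * σ) * R x := by have := hR0 x; positivity
        linarith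
      rwa [one_div_mul_eq_div, div_le_one (by positivity)] at h1
    have hRx : R x ≤ 288 * σ := by
      have h1 : 1 / (288 * σ) * R x ≤ 1 := by
        have : 0 ≤ 1 / (72 * σ) * D x := by have := hD0 x; positivity
        linarith
      rwa [one_div_mul_eq_div, div_le_one (by positivity)] at h1
    have hcs : σ ^ 2 ≤ (∑ i, invFreq x i * d i ^ 2) * D x := by
      refine Finset.sum_sq_le_sum_mul_sum_of_sq_le_mul Finset.univ
        (fun i _ => by have := (invFreq_pos x i).le; positivity) (fun i _ => by positivity)
        (fun i _ => ?_)
      have h1 := hp i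
      have h2 : 0 < τ + (occ i x : ℝ) / s := by positivity
      rw [invFreq, ← hτdef]
      refine le_of_eq ?_
      field_simp
    have hS0 : 0 ≤ ∑ i, invFreq x i * d i ^ 2 := Finset.sum_nonneg fun i _ => by
      have := (invFreq_pos x i).le; positivity
    have : σ ≤ 72 * ∑ i, invFreq x i * d i ^ 2 := by
      have h1 : σ ^ 2 ≤ (∑ i, invFreq x i * d i ^ 2) * (72 * σ) :=
        hcs.trans (mul_le_mul_of_nonneg_left hDx hS0)
      nlinarith
    change R x ≤ _
    linarith

/-- The event that the test function separates `p` from uniform in mean by six standard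
deviations of an average of `m` draws, under either of the two. -/
def Separates (p : Fin n → ℝ) (m : ℕ) (f : Fin n → ℝ) : Prop :=
  0 < ∑ i, (p i - 1 / n) * f i ∧
    36 * ∑ i, 1 / (n : ℝ) * f i ^ 2 ≤ m * (∑ i, (p i - 1 / n) * f i) ^ 2 ∧
    36 * ∑ i, p i * f i ^ 2 ≤ m * (∑ i, (p i - 1 / n) * f i) ^ 2

/-- With the weights fixed, the gap `G` is affine in the empirical frequencies of `x`, with mean `S`
and variance at most `R / s`. The second moments `V` have mean at most `R + 3 S + 3 / (n s τ²)`.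
Both are then controlled by Markov. -/
theorem testFun_good {p : Fin n → ℝ} (hp : ∀ i, 0 ≤ p i) (hp1 : ∑ i, p i = 1) {s m : ℕ}
    (hm : 0 < m) (hms : m ≤ s) (x' : Fin s → Fin n) {S : ℝ}
    (hS : S = ∑ i, invFreq x' i * (p i - 1 / n) ^ 2) (hS0 : 0 < S)
    (hR : ∑ i, p i * invFreq x' i ^ 2 * (p i - 1 / n) ^ 2 ≤ 20736 * S)
    (h1 : 72 * (148 * 20736 + 432) ≤ m * S)
    (h2 : 72 * 432 ≤ m * n * s * smoothing n s ^ 2 * S ^ 2) :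
    35 / 36 ≤ iidExpect p s ({x | Separates p m (testFun x' x)}.indicator 1) := by
  have hn : (0 : ℝ) < n := by exact_mod_cast NeZero.pos n
  have hm' : (0 : ℝ) < m := by exact_mod_cast hm
  have hs : 0 < s := hm.trans_le hms
  have hs' : (0 : ℝ) < s := by exact_mod_cast hs
  have hms' : (m : ℝ) ≤ s := by exact_mod_cast hms
  have hnτ : 1 ≤ n * smoothing n s := one_le_mul_smoothing s
  have hsτ : 1 ≤ s * smoothing n s := one_le_mul_smoothing' hs
  have hτ : 0 < smoothing n s := smoothing_pos s
  set τ := smoothing n s with hτdef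
  set R := ∑ i, p i * invFreq x' i ^ 2 * (p i - 1 / n) ^ 2 with hRdef
  have hw0 := fun i => invFreq_pos x' i
  have hwτ : ∀ i, invFreq x' i * τ ≤ 1 := fun i => by
    have := invFreq_le x' i
    rwa [le_div_iff₀ hτ] at this
  let G : (Fin s → Fin n) → ℝ := fun x => ∑ i, (p i - 1 / n) * testFun x' x i
  let V : (Fin s → Fin n) → ℝ := fun x => ∑ i, (1 / n + p i) * testFun x' x i ^ 2
  have hV0 : ∀ x, 0 ≤ V x := fun x => Finset.sum_nonneg fun i _ => by
    have := hp i; positivity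
  have hG : iidExpect p s (fun x => (G x - S) ^ 2) ≤ R / s := by
    have h := iidExpect_mean_sub_sq_le hp1 (fun i => invFreq x' i * (p i - 1 / n)) hs
      (∑ i, p i * (invFreq x' i * (p i - 1 / n)))
    have e : ∀ x : Fin s → Fin n, G x - S = (∑ j, invFreq x' (x j) * (p (x j) - 1 / n)) / s -
        ∑ i, p i * (invFreq x' i * (p i - 1 / n)) := fun x => by
      rw [← sum_mul_occ (fun i => invFreq x' i * (p i - 1 / n)), Finset.sum_div, hS,
        ← Finset.sum_sub_distrib, ← Finset.sum_sub_distrib]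
      exact Finset.sum_congr rfl fun i _ => by rw [testFun]; ring
    simp only [e]
    refine h.trans_eq ?_
    rw [sub_self, hRdef]
    simp only [ne_eq, OfNat.ofNat_ne_zero, not_false_eq_true, zero_pow, add_zero, mul_pow,
      mul_assoc]
  have hV : iidExpect p s V ≤ R + 3 * S + 3 / (n * s * τ ^ 2) := by
    have hterm : ∀ i, iidExpect p s (fun x => (1 / n + p i) * testFun x' x i ^ 2) ≤
        p i * invFreq x' i ^ 2 * (p i - 1 / n) ^ 2 + 3 * (invFreq x' i * (p i - 1 / n) ^ 2)
          + (p i * (1 / (n * s * τ ^ 2)) + 2 * (1 / n) * (1 / (n * s * τ ^ 2))) := fun i => by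
      have e : (fun x => (1 / n + p i) * testFun x' x i ^ 2) = fun x : Fin s → Fin n =>
          ((1 / n + p i) * invFreq x' i ^ 2) * ((occ i x : ℝ) / s - 1 / n) ^ 2 := by
        funext x; rw [testFun]; ring
      have hpi := hp i
      have hwi := hw0 i
      rw [e, iidExpect_const_mul]
      generalize hw : invFreq x' i = w at *
      have hwi' : w * τ ≤ 1 := hw ▸ hwτ i
      generalize hd : p i - 1 / n = d
      -- Splitting `p i` into `d + 1/n` lets the sampling variance be absorbed by `S` and a `1/n²`
      -- term, so no bound on `∑ p i ^ 2` is required.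
      have hpd : p i ^ 2 ≤ 2 * d ^ 2 + 2 * (1 / n) ^ 2 := by
        have : p i = d + 1 / n := by rw [← hd]; ring
        rw [this]; nlinarith [sq_nonneg (d - 1 / n)]
      have hw2 : w ^ 2 ≤ 1 / τ ^ 2 := by
        rw [le_div_iff₀ (by positivity), ← mul_pow]
        exact pow_le_one₀ (by positivity) hwi'
      have hwn : 1 / n * w ≤ 1 := by
        rw [one_div_mul_eq_div, div_le_one hn]
        nlinarith
      have hws : w / s ≤ 1 := by
        rw [div_le_one hs']
        nlinarith
      calc (1 / n + p i) * w ^ 2 * iidExpect p s (fun x => ((occ i x : ℝ) / s - 1 / n) ^ 2)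
          ≤ (1 / n + p i) * w ^ 2 * (p i / s + d ^ 2) := by
            rw [← hd]; gcongr; exact iidExpect_freq_sub_sq_le hp1 i hs _
        _ = p i * w ^ 2 * d ^ 2 + (1 / n * w) * (w * d ^ 2) + (1 / n * (p i / s)) * w ^ 2
              + p i ^ 2 * (w ^ 2 / s) := by ring
        _ ≤ p i * w ^ 2 * d ^ 2 + 1 * (w * d ^ 2) + (1 / n * (p i / s)) * (1 / τ ^ 2)
              + (2 * d ^ 2 + 2 * (1 / n) ^ 2) * (w ^ 2 / s) := by gcongr
        _ = p i * w ^ 2 * d ^ 2 + 1 * (w * d ^ 2) + (1 / n * (p i / s)) * (1 / τ ^ 2)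
              + 2 * (w / s) * (w * d ^ 2) + 2 * (1 / n) ^ 2 / s * w ^ 2 := by ring
        _ ≤ p i * w ^ 2 * d ^ 2 + 1 * (w * d ^ 2) + (1 / n * (p i / s)) * (1 / τ ^ 2)
              + 2 * 1 * (w * d ^ 2) + 2 * (1 / n) ^ 2 / s * (1 / τ ^ 2) := by gcongr
        _ = _ := by field_simp; ring
    rw [iidExpect_sum]
    refine (Finset.sum_le_sum fun i _ => hterm i).trans_eq ?_
    simp only [Finset.sum_add_distrib, ← Finset.mul_sum, ← Finset.sum_mul, hp1, ← hS, ← hRdef]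
    simp only [Finset.sum_const, Finset.card_univ, Fintype.card_fin, nsmul_eq_mul]
    field_simp; ring
  -- The first term below `1` gives `G > S / 2`; the second gives `36 V < m (S / 2)²`.
  have key := one_sub_le_iidExpect_indicator hp hp1
    (F := fun x => 4 / S ^ 2 * (G x - S) ^ 2 + 144 / (m * S ^ 2) * V x)
    (fun x => by have := hV0 x; positivity) {x | Separates p m (testFun x' x)}
    (fun x hx => ?_)
  · refine le_trans ?_ key
    rw [iidExpect_add, iidExpect_const_mul, iidExpect_const_mul]
    have hR0 : 0 ≤ R := Finset.sum_nonneg fun i _ => by have := hp i; positivity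
    have b1 : 4 / S ^ 2 * iidExpect p s (fun x => (G x - S) ^ 2) ≤
        4 / S ^ 2 * (20736 * S / m) := by
      gcongr
      exact hG.trans (div_le_div₀ (hR0.trans hR) hR hm' hms')
    have b2 : 144 / (m * S ^ 2) * iidExpect p s V ≤
        144 / (m * S ^ 2) * (20736 * S + 3 * S + 3 / (n * s * τ ^ 2)) := by
      gcongr
      linarith
    have e : 4 / S ^ 2 * (20736 * S / m) +
        144 / (m * S ^ 2) * (20736 * S + 3 * S + 3 / (n * s * τ ^ 2)) =
        (148 * 20736 + 432) / (m * S) + 432 / (m * n * s * τ ^ 2 * S ^ 2) := by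
      field_simp; ring
    have c1 : (148 * 20736 + 432) / (m * S) ≤ 1 / 72 := by
      rw [div_le_div_iff₀ (by positivity) (by norm_num)]; linarith
    have c2 : 432 / (m * n * s * τ ^ 2 * S ^ 2) ≤ 1 / 72 := by
      rw [div_le_div_iff₀ (by positivity) (by norm_num)]; linarith
    linarith
  · have hG1 : 4 / S ^ 2 * (G x - S) ^ 2 < 1 := by
      have : 0 ≤ 144 / (m * S ^ 2) * V x := by have := hV0 x; positivity
      linarith
    have hV1 : 144 / (m * S ^ 2) * V x < 1 := by
      have : 0 ≤ 4 / S ^ 2 * (G x - S) ^ 2 := by positivity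
      linarith
    rw [div_mul_eq_mul_div, div_lt_one (by positivity)] at hG1 hV1
    have hGS : S / 2 < G x := by
      have : |2 * (G x - S)| < S := by
        refine abs_lt_of_sq_lt_sq ?_ hS0.le
        linarith [hG1]
      have := (abs_lt.1 this).1
      linarith
    have hVV : V x = ∑ i, 1 / (n : ℝ) * testFun x' x i ^ 2 + ∑ i, p i * testFun x' x i ^ 2 := by
      rw [← Finset.sum_add_distrib]; exact Finset.sum_congr rfl fun i _ => by ring
    have hU0 : 0 ≤ ∑ i, 1 / (n : ℝ) * testFun x' x i ^ 2 :=
      Finset.sum_nonneg fun i _ => by positivity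
    have hP0 : 0 ≤ ∑ i, p i * testFun x' x i ^ 2 :=
      Finset.sum_nonneg fun i _ => by have := hp i; positivity
    have hb : m * (S / 2) ^ 2 ≤ m * G x ^ 2 := by gcongr
    refine ⟨by linarith, ?_, ?_⟩
    · change _ ≤ m * G x ^ 2
      linarith
    · change _ ≤ m * G x ^ 2
      linarith

/-- With probability at least `17 / 18` over two independent batches of `s` samples from `p`, the
test function built from them separates `p` from uniform. -/
theorem separates_good {p : Fin n → ℝ} (hp : ∀ i, 0 ≤ p i) (hp1 : ∑ i, p i = 1) {ε : ℝ}
    (hε : 0 < ε) (hε1 : ε ≤ 1) (hd : 2 * ε ≤ ∑ i, |p i - 1 / n|) {s m : ℕ} (hm : 0 < m)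
    (hms : m ≤ s) (h1 : 3 * 10 ^ 8 ≤ m * ε ^ 2) (h2 : 3 * 10 ^ 8 * n ≤ m * s * ε ^ 4) :
    17 / 18 ≤ iidExpect p s (fun x' => iidExpect p s
      ({x | Separates p m (testFun x' x)}.indicator 1)) := by
  have hn : (0 : ℝ) < n := by exact_mod_cast NeZero.pos n
  have hm' : (0 : ℝ) < m := by exact_mod_cast hm
  have hs : 0 < s := hm.trans_le hms
  have hs' : (0 : ℝ) < s := by exact_mod_cast hs
  have hτ : 0 < smoothing n s := smoothing_pos s
  have hnτ : 1 ≤ n * smoothing n s := one_le_mul_smoothing s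
  have hlow : ∀ x' : Fin s → Fin n,
      2 * ε ^ 2 ≤ n * smoothing n s * ∑ i, invFreq x' i * (p i - 1 / n) ^ 2 := fun x' => by
    have h := sum_abs_sq_le hτ (q := fun i => (occ i x' : ℝ) / s) (fun i => by positivity)
      (by
        rw [← Finset.sum_div]
        have := sum_mul_occ (fun _ => 1) x'
        simp only [one_mul] at this
        rw [this]; simp [hs'.ne']) (fun i => p i - 1 / n)
    change _ ≤ (∑ i, invFreq x' i * (p i - 1 / n) ^ 2) * _ at h
    have hS : 0 ≤ ∑ i, invFreq x' i * (p i - 1 / n) ^ 2 := Finset.sum_nonneg fun i _ => by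
      have := (invFreq_pos x' i).le; positivity
    have h4 : (2 * ε) ^ 2 ≤ (∑ i, |p i - 1 / n|) ^ 2 := by gcongr
    nlinarith
  have hgood := invFreq_good hp hp1 hs (fun i => p i - 1 / n) (by linarith)
  have hstep : iidExpect p s (fun x' => 35 / 36 *
      ({x | ∑ i, p i * invFreq x i ^ 2 * (p i - 1 / n) ^ 2 ≤
      20736 * ∑ i, invFreq x i * (p i - 1 / n) ^ 2}.indicator 1 x' : ℝ)) ≤
      iidExpect p s (fun x' => iidExpect p s
      ({x | Separates p m (testFun x' x)}.indicator 1)) := by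
    refine iidExpect_mono hp fun x' => ?_
    by_cases hx : x' ∈ {x : Fin s → Fin n | ∑ i, p i * invFreq x i ^ 2 * (p i - 1 / n) ^ 2 ≤
      20736 * ∑ i, invFreq x i * (p i - 1 / n) ^ 2}
    · rw [Set.indicator_of_mem hx, Pi.one_apply, mul_one]
      have hl := hlow x'
      generalize hS : ∑ i, invFreq x' i * (p i - 1 / n) ^ 2 = S at hl
      have hnτ0 : 0 < n * smoothing n s := by linarith
      have hS0 : 0 < S := pos_of_mul_pos_right ((by positivity : 0 < 2 * ε ^ 2).trans_le hl)
        hnτ0.le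
      have hmax : m * s * ε ^ 4 ≤ m * s * ε ^ 2 := by
        have : ε ^ 4 ≤ ε ^ 2 := pow_le_pow_of_le_one hε.le hε1 (by norm_num)
        gcongr
      refine testFun_good hp hp1 hm hms x' hS.symm hS0 (hS ▸ hx) ?_ ?_
      · have h3 : 3 * 10 ^ 8 * (n * smoothing n s) ≤ m * ε ^ 2 * (n * smoothing n s) := by
          gcongr
        -- Here `n τ = max 1 (n / s)`: the first value uses `h1`, the second `h2`.
        have h4 : 3 * 10 ^ 8 * (n * smoothing n s) ≤ m * ε ^ 2 := by
          rw [smoothing]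
          rcases max_cases (1 / (n : ℝ)) (1 / s) with ⟨h, -⟩ | ⟨h, -⟩
          · rw [h, mul_one_div_cancel hn.ne', mul_one]; exact h1
          · rw [h, ← mul_assoc, mul_one_div, div_le_iff₀ hs']
            calc _ ≤ _ := h2
              _ ≤ _ := hmax
              _ = _ := by ring
        have h5 : 3 * 10 ^ 8 * (n * smoothing n s) ≤ m * S * (n * smoothing n s) := by
          calc _ ≤ _ := h4
            _ ≤ m * (2 * ε ^ 2) := by nlinarith [mul_pos hm' (pow_pos hε 2)]
            _ ≤ m * (n * smoothing n s * S) := by gcongr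
            _ = _ := by ring
        have := le_of_mul_le_mul_right h5 hnτ0
        linarith
      · have h3 : (2 * ε ^ 2) ^ 2 ≤ (n * smoothing n s * S) ^ 2 := by gcongr
        have h4 : 3 * 10 ^ 8 * (n : ℝ) ≤ m * n * s * smoothing n s ^ 2 * S ^ 2 * n := by
          calc _ ≤ _ := h2
            _ ≤ m * s * (2 * ε ^ 2) ^ 2 := by
              have : ε ^ 4 ≤ (2 * ε ^ 2) ^ 2 := by nlinarith [pow_pos hε 4]
              gcongr
            _ ≤ m * s * (n * smoothing n s * S) ^ 2 := by gcongr
            _ = _ := by ring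
        have := le_of_mul_le_mul_right h4 hn
        linarith
    · rw [Set.indicator_of_notMem hx, mul_zero]
      exact iidExpect_nonneg hp fun x => Set.indicator_nonneg (fun _ _ => zero_le_one) x
  refine le_trans ?_ hstep
  rw [iidExpect_const_mul]
  linarith [hgood]

end Moments

/-! ### Splitting samples into batches; amplification by majority. -/

section Reindex

variable {α : Type*} [Fintype α]

/-- The `b`-th of `t` consecutive batches of `m` samples. -/
def batch {t m : ℕ} (b : Fin t) (y : Fin (t * m) → α) : Fin m → α :=
  fun j => y (finProdFinEquiv (b, j))

theorem iidExpect_prod_batch (p : α → ℝ) (t m : ℕ) (g : (Fin m → α) → ℝ) :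
    iidExpect p (t * m) (fun y => ∏ b : Fin t, g (batch b y)) = iidExpect p m g ^ t := by
  have h := Fintype.sum_pow (fun z : Fin m → α => (∏ j, p (z j)) * g z) t
  rw [iidExpect, iidExpect, h]
  let e : (Fin (t * m) → α) ≃ (Fin t → Fin m → α) :=
    (Equiv.arrowCongr finProdFinEquiv.symm (Equiv.refl α)).trans (Equiv.curry _ _ _)
  rw [← e.sum_comp]
  refine Finset.sum_congr rfl fun y _ => ?_
  rw [Finset.prod_mul_distrib, ← finProdFinEquiv.prod_comp, Fintype.prod_prod_type]
  rfl

theorem iidExpect_append (p : α → ℝ) (s r : ℕ) (F : (Fin s → α) → (Fin r → α) → ℝ) :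
    iidExpect p (s + r) (fun x => F (fun j => x (Fin.castAdd r j)) fun j => x (Fin.natAdd s j)) =
      iidExpect p s fun x' => iidExpect p r (F x') := by
  simp only [iidExpect, Finset.mul_sum]
  rw [← Fintype.sum_prod_type', ← (Fin.appendEquiv s r).sum_comp]
  refine Finset.sum_congr rfl fun x _ => ?_
  simp [Fin.appendEquiv, Fin.prod_univ_add, mul_assoc]

/-- If each of `t` batches is bad with probability at most `1 / 9`, then at least half of them are
bad with probability at most `(2 / 3) ^ t`. -/
theorem iidExpect_majority_le {p : α → ℝ} (hp : ∀ a, 0 ≤ p a) (hp1 : ∑ a, p a = 1) {m : ℕ}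
    (t : ℕ) (W : Set (Fin m → α)) [DecidablePred (· ∈ W)]
    (hW : iidExpect p m (W.indicator 1) ≤ 1 / 9) :
    iidExpect p (t * m) ({y | t ≤ 2 * (Finset.univ.filter fun b : Fin t =>
      batch b y ∈ W).card}.indicator 1) ≤ (2 / 3) ^ t := by
  -- `g` is `2` on bad batches and `1/2` on good ones, so its product is at least `1` when half are
  -- bad, ties included, while its mean is at most `1/2 + 1/6`.
  let g : (Fin m → α) → ℝ := fun z => 1 / 2 + 3 / 2 * W.indicator 1 z
  have hg0 : ∀ z, 0 ≤ g z := fun z => by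
    have : 0 ≤ W.indicator (1 : (Fin m → α) → ℝ) z :=
      Set.indicator_nonneg (fun _ _ => zero_le_one) z
    positivity
  have hg : iidExpect p m g ≤ 2 / 3 := by
    rw [iidExpect_add, iidExpect_const_mul, iidExpect_const hp1]; linarith
  calc _ ≤ iidExpect p (t * m) (fun y => ∏ b : Fin t, g (batch b y)) := by
        refine iidExpect_indicator_le hp (fun y => Finset.prod_nonneg fun b _ => hg0 _) _
          fun y hy => ?_
        have hgz : ∀ z, g z = if z ∈ W then 2 else 1 / 2 := fun z => by
          by_cases hz : z ∈ W
          · simp only [g, hz, Set.indicator_of_mem, Pi.one_apply, if_true]; norm_num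
          · simp [g, hz]
        simp only [hgz]
        rw [Finset.prod_ite, Finset.prod_const, Finset.prod_const]
        have hc := Finset.card_filter_add_card_filter_not (s := (Finset.univ : Finset (Fin t)))
          (fun b => batch b y ∈ W)
        rw [Finset.card_univ, Fintype.card_fin] at hc
        have hy' : (Finset.univ.filter fun b : Fin t => ¬ batch b y ∈ W).card ≤
            (Finset.univ.filter fun b : Fin t => batch b y ∈ W).card := by
          have : t ≤ 2 * (Finset.univ.filter fun b : Fin t => batch b y ∈ W).card := hy
          omega
        rw [one_div_pow, mul_one_div, le_div_iff₀ (by positivity), one_mul]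
        exact pow_le_pow_right₀ (by norm_num) hy'
    _ = iidExpect p m g ^ t := iidExpect_prod_batch p t m g
    _ ≤ (2 / 3) ^ t := pow_le_pow_left₀ (iidExpect_nonneg hp hg0) hg t

theorem iidExpect_deviation_le {p : α → ℝ} (hp : ∀ a, 0 ≤ p a) (hp1 : ∑ a, p a = 1)
    (f : α → ℝ) {m : ℕ} (hm : 0 < m) {a : ℝ} (ha : 0 < a)
    (hV : 9 * ∑ i, p i * f i ^ 2 ≤ m * a ^ 2) (A : Set (Fin m → α))
    (hA : ∀ y ∈ A, a ≤ |(∑ j, f (y j)) / m - ∑ i, p i * f i|) :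
    iidExpect p m (A.indicator 1) ≤ 1 / 9 := by
  have hm' : (0 : ℝ) < m := by exact_mod_cast hm
  refine (iidExpect_indicator_le hp
    (F := fun y => 1 / a ^ 2 * ((∑ j, f (y j)) / m - ∑ i, p i * f i) ^ 2)
    (fun y => by positivity) A fun y hy => ?_).trans ?_
  · rw [one_div_mul_eq_div, one_le_div (by positivity), ← sq_abs (_ - _)]
    exact pow_le_pow_left₀ ha.le (hA y hy) 2
  · rw [iidExpect_const_mul]
    have h := iidExpect_mean_sub_sq_le hp1 f hm (∑ i, p i * f i)
    rw [sub_self, zero_pow two_ne_zero, add_zero] at h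
    have h2 : (∑ i, p i * f i ^ 2) / m ≤ a ^ 2 / 9 := by
      rw [div_le_div_iff₀ hm' (by norm_num)]; linarith
    calc _ ≤ 1 / a ^ 2 * (a ^ 2 / 9) := by gcongr; exact h.trans h2
      _ = 1 / 9 := by field_simp

end Reindex

/-! ### The test on a single distribution. -/

section Vote

variable {n : ℕ}

/-- A batch votes against uniformity if the empirical mean of `f` exceeds its mean under the uniform
distribution by more than three standard deviations. -/
def Vote {m : ℕ} (f : Fin n → ℝ) (y : Fin m → Fin n) : Prop :=
  3 * √((∑ i, 1 / (n : ℝ) * f i ^ 2) / m) < (∑ j, f (y j)) / m - ∑ i, 1 / (n : ℝ) * f i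

theorem mul_vote_threshold_sq {m : ℕ} (hm : 0 < m) (f : Fin n → ℝ) :
    m * (3 * √((∑ i, 1 / (n : ℝ) * f i ^ 2) / m)) ^ 2 =
      9 * ∑ i, 1 / (n : ℝ) * f i ^ 2 := by
  have hm' : (0 : ℝ) < m := by exact_mod_cast hm
  have h0 : 0 ≤ ∑ i, 1 / (n : ℝ) * f i ^ 2 := Finset.sum_nonneg fun i _ => by positivity
  rw [mul_pow, Real.sq_sqrt (by positivity), mul_left_comm, mul_div_cancel₀ _ hm'.ne']
  norm_num

theorem vote_uniform_le [NeZero n] {m : ℕ} (hm : 0 < m) (f : Fin n → ℝ) :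
    iidExpect (fun _ : Fin n => 1 / (n : ℝ)) m ({y | Vote f y}.indicator 1) ≤ 1 / 9 := by
  have hn : (0 : ℝ) < n := by exact_mod_cast NeZero.pos n
  have hm' : (0 : ℝ) < m := by exact_mod_cast hm
  have hV0 : 0 ≤ ∑ i, 1 / (n : ℝ) * f i ^ 2 := Finset.sum_nonneg fun i _ => by positivity
  rcases hV0.eq_or_lt with h | h
  -- Zero threshold: `f` vanishes, and the strict inequality in `Vote` rules out a vote.
  · have hf : ∀ i, f i = 0 := fun i => by
      have h1 := (Finset.sum_eq_zero_iff_of_nonneg fun i _ => by positivity).1 h.symm i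
        (Finset.mem_univ i)
      have h2 : 1 / (n : ℝ) ≠ 0 := by positivity
      simpa [h2, hn.ne'] using h1
    have : {y : Fin m → Fin n | Vote f y} = ∅ := by
      ext y; simp [Vote, hf]
    rw [this, Set.indicator_empty]
    simp [iidExpect]
  · refine iidExpect_deviation_le (fun _ => by positivity) (by simp [hn.ne']) f hm
      (a := 3 * √((∑ i, 1 / (n : ℝ) * f i ^ 2) / m)) (by positivity)
      (mul_vote_threshold_sq hm f).ge _ fun y hy => ?_
    exact (le_of_lt hy).trans (le_abs_self _)

/-- Separation by six standard deviations puts the threshold at most halfway up the gap `G`, so a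
missing vote means a deviation of at least `G / 2` below the mean under `p`, which is again three
standard deviations. -/
theorem not_vote_le {p : Fin n → ℝ} (hp : ∀ i, 0 ≤ p i) (hp1 : ∑ i, p i = 1) {m : ℕ}
    (hm : 0 < m) {f : Fin n → ℝ} (hf : Separates p m f) :
    iidExpect p m ({y | ¬ Vote f y}.indicator 1) ≤ 1 / 9 := by
  have hm' : (0 : ℝ) < m := by exact_mod_cast hm
  obtain ⟨hG, hU, hP⟩ := hf
  have hGe : ∑ i, (p i - 1 / n) * f i = ∑ i, p i * f i - ∑ i, 1 / (n : ℝ) * f i := by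
    rw [← Finset.sum_sub_distrib]; exact Finset.sum_congr rfl fun i _ => by ring
  set G := ∑ i, (p i - 1 / n) * f i with hGdef
  refine iidExpect_deviation_le hp hp1 f hm (a := G / 2) (by positivity) (by nlinarith) _
    fun y hy => ?_
  have h1 : 3 * √((∑ i, 1 / (n : ℝ) * f i ^ 2) / m) ≤ G / 2 := by
    refine abs_le_of_sq_le_sq' ?_ (by positivity) |>.2
    have h2 := mul_vote_threshold_sq hm f
    have h3 : m * (3 * √((∑ i, 1 / (n : ℝ) * f i ^ 2) / m)) ^ 2 ≤ m * (G / 2) ^ 2 := by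
      rw [h2]; linarith
    exact le_of_mul_le_mul_left h3 hm'
  have h2 := not_lt.1 (show ¬ _ < _ from hy)
  rw [abs_sub_comm]
  refine le_trans ?_ (le_abs_self _)
  linarith

/-- The majority decision over `t` batches. -/
def Majority {t m : ℕ} (f : Fin n → ℝ) (y : Fin (t * m) → Fin n) : Prop :=
  t ≤ 2 * Nat.card {b : Fin t // Vote f (batch b y)}

theorem majority_uniform_le [NeZero n] {m : ℕ} (hm : 0 < m) (t : ℕ) (f : Fin n → ℝ) :
    iidExpect (fun _ : Fin n => 1 / (n : ℝ)) (t * m)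
      ({y | Majority (t := t) (m := m) f y}.indicator 1) ≤ (2 / 3) ^ t := by
  classical
  have hn : (0 : ℝ) < n := by exact_mod_cast NeZero.pos n
  have h := iidExpect_majority_le (p := fun _ : Fin n => 1 / (n : ℝ)) (fun _ => by positivity)
    (by simp [hn.ne']) t {y | Vote f y} (vote_uniform_le hm f)
  simpa only [Majority, Nat.card_eq_fintype_card, Fintype.card_subtype, Set.mem_ofPred_eq] using h

theorem not_majority_le {p : Fin n → ℝ} (hp : ∀ i, 0 ≤ p i) (hp1 : ∑ i, p i = 1) {m : ℕ}
    (hm : 0 < m) (t : ℕ) {f : Fin n → ℝ} (hf : Separates p m f) :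
    iidExpect p (t * m) ({y | ¬ Majority (t := t) (m := m) f y}.indicator 1) ≤ (2 / 3) ^ t := by
  classical
  refine le_trans (iidExpect_mono hp fun y => ?_)
    (iidExpect_majority_le hp hp1 t {y | ¬ Vote f y} (not_vote_le hp hp1 hm hf))
  refine Set.indicator_le_indicator_of_subset (fun y hy => ?_) (fun _ => zero_le_one) y
  have hc := Finset.card_filter_add_card_filter_not (s := (Finset.univ : Finset (Fin t)))
    (fun b => Vote f (batch (m := m) b y))
  simp only [Majority, Nat.card_eq_fintype_card, Fintype.card_subtype, Set.mem_ofPred_eq,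
    Finset.card_univ, Fintype.card_fin] at hy hc ⊢
  omega

end Vote

/-! ### From measures to finite sums. -/

section Bridge

theorem pi_toMeasure_apply {n : ℕ} (P : PMF (Fin n)) (s : ℕ) (A : Set (Fin s → Fin n)) :
    (Measure.pi fun _ : Fin s => P.toMeasure) A =
      ENNReal.ofReal (iidExpect (fun i => (P i).toReal) s (A.indicator 1)) := by
  classical
  have h0 : ∀ x : Fin s → Fin n, 0 ≤ ∏ j, (P (x j)).toReal := fun x =>
    Finset.prod_nonneg fun _ _ => ENNReal.toReal_nonneg
  rw [iidExpect, ENNReal.ofReal_sum_of_nonneg fun x _ => mul_nonneg (h0 x)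
    (Set.indicator_nonneg (f := (1 : (Fin s → Fin n) → ℝ)) (fun _ _ => zero_le_one) x)]
  rw [← lintegral_indicator_one (MeasurableSet.of_discrete), lintegral_fintype]
  refine Finset.sum_congr rfl fun x _ => ?_
  rw [Measure.pi_singleton]
  by_cases hx : x ∈ A
  · simp only [hx, Set.indicator_of_mem, Pi.one_apply, one_mul, mul_one]
    rw [ENNReal.ofReal_prod_of_nonneg fun _ _ => ENNReal.toReal_nonneg]
    refine Finset.prod_congr rfl fun j _ => ?_
    rw [PMF.toMeasure_apply_singleton _ _ (measurableSet_singleton _),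
      ENNReal.ofReal_toReal (P.apply_ne_top _)]
  · simp [hx]

theorem sum_toReal_pmf {n : ℕ} (P : PMF (Fin n)) : ∑ i, (P i).toReal = 1 := by
  rw [← ENNReal.toReal_sum fun i _ => P.apply_ne_top i, ← tsum_fintype (L := .unconditional _), P.tsum_coe]
  rfl

theorem unif_toReal (n : ℕ) [NeZero n] (i : Fin n) : (unif n i).toReal = 1 / n := by
  simp [unif, PMF.uniformOfFintype_apply]

theorem two_mul_tvDist_unif {n : ℕ} [NeZero n] (P : PMF (Fin n)) :
    2 * tvDist P (unif n) = ∑ i, |(P i).toReal - 1 / n| := by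
  simp only [tvDist, unif_toReal]; ring

end Bridge

/-! ### The classifier and its correctness. -/

open Classical in
/-- Classify as `P` the indices for which the majority of `t` batches of `m` samples votes against
uniformity, with test function built from two batches of `s` samples from `P`. -/
noncomputable def majorityClassifier (n k s t m : ℕ) : Classifier n k where
  s₁ := s + s
  s₂ := t * m
  output d := PMF.pure (Finset.univ.filter fun i => Majority (t := t) (m := m)
    (testFun (fun j => d.1 (Fin.castAdd s j)) fun j => d.1 (Fin.natAdd s j)) (d.2 i))

/-- All `k` tests share one test function. Once the samples from `P` make it separating, a union
bound over the tests fails with probability at most `1/18`; Fubini combines the two stages, and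
`(17/18)² ≥ 8/9`. -/
theorem majorityClassifier_good {n k s t m : ℕ} [NeZero n] (P : PMF (Fin n)) {ε : ℝ}
    (hε : 0 < ε) (hε1 : ε ≤ 1) (hd : ε ≤ tvDist P (unif n)) (hm : 0 < m)
    (hms : m ≤ s) (h1 : 3 * 10 ^ 8 ≤ m * ε ^ 2) (h2 : 3 * 10 ^ 8 * n ≤ m * s * ε ^ 4)
    (ht : k * (2 / 3 : ℝ) ^ t ≤ 1 / 18) (χ : Finset (Fin k)) :
    8 / 9 ≤ (majorityClassifier n k s t m).successProb P χ := by
  classical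
  let p : Fin n → ℝ := fun i => (P i).toReal
  have hp : ∀ i, 0 ≤ p i := fun i => ENNReal.toReal_nonneg
  have hp1 : ∑ i, p i = 1 := sum_toReal_pmf P
  let F : (Fin (s + s) → Fin n) → Fin n → ℝ := fun x =>
    testFun (fun j => x (Fin.castAdd s j)) fun j => x (Fin.natAdd s j)
  let μ : Measure (Fin (s + s) → Fin n) := Measure.pi fun _ => P.toMeasure
  let κ : Fin k → Measure (Fin (t * m) → Fin n) := fun i =>
    Measure.pi fun _ => (instanceDist P χ i).toMeasure
  let A : Set (Fin (s + s) → Fin n) := {x | Separates p m (F x)}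
  let c : ℝ≥0∞ := ENNReal.ofReal (17 / 18)
  have hA : c ≤ μ A := by
    rw [show μ A = _ from pi_toMeasure_apply P (s + s) A]
    refine ENNReal.ofReal_le_ofReal ?_
    refine (separates_good hp hp1 hε hε1 ?_ hm hms h1 h2).trans_eq ?_
    · rw [← two_mul_tvDist_unif]; linarith
    · rw [← iidExpect_append]
      rfl
  have hinner : ∀ x ∈ A, c ≤ ∫⁻ y, (majorityClassifier n k s t m).output (x, y) χ
      ∂(Measure.pi κ) := fun x hx => by
    let B : Fin k → Set (Fin (t * m) → Fin n) := fun i =>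
      {y | ¬ (Majority (t := t) (m := m) (F x) y ↔ i ∈ χ)}
    have hB : ∀ i, κ i (B i) ≤ ENNReal.ofReal ((2 / 3) ^ t) := fun i => by
      rw [show κ i (B i) = _ from pi_toMeasure_apply _ _ _]
      refine ENNReal.ofReal_le_ofReal ?_
      by_cases hi : i ∈ χ
      · simp only [instanceDist, hi, if_true, B, iff_true]
        exact not_majority_le hp hp1 hm t hx
      · simp only [instanceDist, hi, if_false, B, iff_false, not_not, unif_toReal]
        exact majority_uniform_le hm t (F x)
    let E : Set (Fin k → Fin (t * m) → Fin n) := ⋃ i, Function.eval i ⁻¹' B i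
    have hE : Measure.pi κ E ≤ ENNReal.ofReal (1 / 18) := by
      calc Measure.pi κ E ≤ ∑ i, Measure.pi κ (Function.eval i ⁻¹' B i) :=
            measure_iUnion_fintype_le _ _
        _ = ∑ i, κ i (B i) := Finset.sum_congr rfl fun i _ =>
            (measurePreserving_eval κ i).measure_preimage
              (MeasurableSet.of_discrete).nullMeasurableSet
        _ ≤ ∑ _i : Fin k, ENNReal.ofReal ((2 / 3) ^ t) := Finset.sum_le_sum fun i _ => hB i
        _ = ENNReal.ofReal (k * (2 / 3) ^ t) := by
            rw [Finset.sum_const, Finset.card_univ, Fintype.card_fin, nsmul_eq_mul,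
              ENNReal.ofReal_mul (Nat.cast_nonneg _), ENNReal.ofReal_natCast]
        _ ≤ _ := ENNReal.ofReal_le_ofReal ht
    calc c = 1 - ENNReal.ofReal (1 / 18) := by
          rw [← ENNReal.ofReal_one, ← ENNReal.ofReal_sub _ (by norm_num)]; norm_num [c]
      _ ≤ 1 - Measure.pi κ E := tsub_le_tsub_left hE 1
      _ = Measure.pi κ Eᶜ := (prob_compl_eq_one_sub MeasurableSet.of_discrete).symm
      _ = ∫⁻ y, Eᶜ.indicator 1 y ∂(Measure.pi κ) :=
          (lintegral_indicator_one MeasurableSet.of_discrete).symm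
      _ ≤ _ := lintegral_mono fun y => by
          by_cases hy : y ∈ Eᶜ
          · have : (Finset.univ.filter fun i => Majority (t := t) (m := m) (F x) (y i)) = χ := by
              ext i
              simp only [E, Set.mem_compl_iff, Set.mem_iUnion, not_exists] at hy
              simpa [B] using hy i
            have h : (majorityClassifier n k s t m).output (x, y) = PMF.pure χ := by
              rw [← this]; simp only [majorityClassifier, F]
            rw [h]
            simp [hy]
          · simp [hy]
  calc (8 / 9 : ℝ≥0∞) = ENNReal.ofReal (8 / 9) := by
        rw [ENNReal.ofReal_div_of_pos (by norm_num)]; simp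
    _ ≤ c * c := by
        rw [← ENNReal.ofReal_mul (by norm_num)]
        exact ENNReal.ofReal_le_ofReal (by norm_num)
    _ ≤ c * μ A := by gcongr
    _ = ∫⁻ x, A.indicator (fun _ => c) x ∂μ :=
        (lintegral_indicator_const MeasurableSet.of_discrete c).symm
    _ ≤ ∫⁻ x, ∫⁻ y, (majorityClassifier n k s t m).output (x, y) χ ∂(Measure.pi κ) ∂μ :=
        lintegral_mono fun x => by
          by_cases hx : x ∈ A
          · simpa [hx] using hinner x hx
          · simp [hx]
    _ = (majorityClassifier n k s t m).successProb P χ :=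
        (lintegral_prod (μ := μ) (ν := Measure.pi κ)
          (fun z => (majorityClassifier n k s t m).output z χ)
          (Measurable.of_discrete).aemeasurable).symm

/-! ### Choice of parameters and sample count. -/

theorem mul_two_thirds_pow_le {k t : ℕ} (hk : 2 ≤ k) (ht : 18 * Real.log k ≤ t) :
    k * (2 / 3 : ℝ) ^ t ≤ 1 / 18 := by
  have hk' : (2 : ℝ) ≤ k := by exact_mod_cast hk
  have hk0 : (0 : ℝ) < k := by linarith
  have h1 : (2 / 3 : ℝ) ^ t ≤ 1 / (k : ℝ) ^ 6 := by
    have h2 : (2 / 3 : ℝ) ≤ Real.exp (-(1 / 3)) := by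
      have := Real.add_one_le_exp (-(1 / 3) : ℝ); linarith
    calc (2 / 3 : ℝ) ^ t ≤ Real.exp (-(1 / 3)) ^ t := by gcongr
      _ = Real.exp (t * -(1 / 3)) := (Real.exp_nat_mul _ _).symm
      _ ≤ Real.exp (-((6 : ℕ) * Real.log k)) := Real.exp_le_exp.2 (by push_cast; linarith)
      _ = 1 / (k : ℝ) ^ 6 := by
        rw [Real.exp_neg, Real.exp_nat_mul, Real.exp_log hk0, one_div]
  calc k * (2 / 3 : ℝ) ^ t ≤ k * (1 / (k : ℝ) ^ 6) := by gcongr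
    _ = 1 / (k : ℝ) ^ 5 := by field_simp
    _ ≤ 1 / 2 ^ 5 := by gcongr
    _ ≤ 1 / 18 := by norm_num

/-- The classifier exists with `O(√(M k log k) / ε²)` samples whenever `M ≥ max n (c k log k)`. -/
theorem exists_classifier {c : ℝ} (hc : 0 < c) {n k : ℕ} [NeZero n] {ε M : ℝ} (hk : 2 ≤ k)
    (hε : 0 < ε) (hε1 : ε ≤ 1) (hnM : n ≤ M) (hcM : c * (k * Real.log k) ≤ M) :
    ∃ A : Classifier n k,
      (A.samples : ℝ) ≤ (22 * (3 * 10 ^ 8 * (1 + 1 / √c)) + 2 + 20 / √c) *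
        (√(M * (k * Real.log k)) / ε ^ 2) ∧
      ∀ P : PMF (Fin n), ε ≤ tvDist P (unif n) →
        ∀ χ : Finset (Fin k), 8 / 9 ≤ A.successProb P χ := by
  have hk' : (2 : ℝ) ≤ k := by exact_mod_cast hk
  have hn : (1 : ℝ) ≤ n := by exact_mod_cast NeZero.one_le
  have hM : 1 ≤ M := hn.trans hnM
  have hl : 1 / 2 ≤ Real.log k := by
    have h1 := Real.log_two_gt_d9
    have h2 := Real.log_le_log (by norm_num) hk'
    linarith
  have hε2 : 0 < ε ^ 2 := by positivity
  have hε21 : ε ^ 2 ≤ 1 := pow_le_one₀ hε.le hε1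
  generalize hL : (k : ℝ) * Real.log k = L at *
  have hL1 : 1 ≤ L := by nlinarith
  have hL0 : 0 < L := by linarith
  have hM0 : 0 < M := by linarith
  have hsc : 0 < √c := Real.sqrt_pos.2 hc
  generalize hK : (3 * 10 ^ 8 * (1 + 1 / √c) : ℝ) = K
  have hK1 : 3 * 10 ^ 8 ≤ K := by
    have : 0 < 1 / √c := by positivity
    linarith
  have hKc : 3 * 10 ^ 8 ≤ K * √c := by
    have : K * √c = 3 * 10 ^ 8 * (√c + 1) := by rw [← hK]; field_simp
    rw [this]; linarith
  have hK0 : 0 < K := by linarith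
  -- Up to the factor `K / ε²`, `a` is the size of `s` and `b` that of `m`. `a = L b` balances the
  -- two costs, `a b = M ≥ n` gives the product condition, and `b ≥ √c` gives the condition on `m`
  -- alone.
  generalize ha : √(M * L) = a
  generalize hb : √(M / L) = b
  have ha1 : 1 ≤ a := by rw [← ha]; exact Real.one_le_sqrt.2 (by nlinarith)
  have haL : a = L * b := by
    rw [← ha, ← hb, ← Real.sqrt_sq hL0.le, ← Real.sqrt_mul (by positivity),
      Real.sqrt_sq hL0.le]
    congr 1; field_simp
  have hbc : √c ≤ b := by
    rw [← hb]; exact Real.sqrt_le_sqrt (by rw [le_div_iff₀ hL0]; exact hcM)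
  have hb0 : 0 < b := hsc.trans_le hbc
  have hab : a * b = M := by
    rw [← ha, ← hb, ← Real.sqrt_mul (by positivity)]
    rw [show M * L * (M / L) = M ^ 2 by field_simp, Real.sqrt_sq hM0.le]
  have hba : b ≤ a := by rw [haL]; nlinarith
  let s := ⌈K * a / ε ^ 2⌉₊
  let m := ⌈K * b / ε ^ 2⌉₊
  let t := ⌈18 * Real.log k⌉₊
  have hs : K * a / ε ^ 2 ≤ s := Nat.le_ceil _
  have hm : K * b / ε ^ 2 ≤ m := Nat.le_ceil _
  have ht : 18 * Real.log k ≤ t := Nat.le_ceil _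
  have hs' : (s : ℝ) < K * a / ε ^ 2 + 1 := Nat.ceil_lt_add_one (by positivity)
  have hm' : (m : ℝ) < K * b / ε ^ 2 + 1 := Nat.ceil_lt_add_one (by positivity)
  have ht' : (t : ℝ) < 18 * Real.log k + 1 := Nat.ceil_lt_add_one (by positivity)
  have hm0 : 0 < m := Nat.ceil_pos.2 (by positivity)
  have hms : m ≤ s := Nat.ceil_mono (by gcongr)
  rw [div_le_iff₀ hε2] at hs hm
  refine ⟨majorityClassifier n k s t m, ?_, fun P hd χ =>
    majorityClassifier_good P hε hε1 hd hm0 hms ?_ ?_ (mul_two_thirds_pow_le hk ht) χ⟩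
  · have e : ((majorityClassifier n k s t m).samples : ℝ) = s + s + k * (t * m) := by
      simp [Classifier.samples, majorityClassifier]
    rw [e]
    have h1 : 1 ≤ 1 / ε ^ 2 := by rw [le_div_iff₀ hε2]; linarith
    have bs : (s : ℝ) ≤ (K + 1) * (a / ε ^ 2) := by
      have : 1 ≤ a / ε ^ 2 := by rw [le_div_iff₀ hε2]; linarith
      calc (s : ℝ) ≤ K * a / ε ^ 2 + 1 := hs'.le
        _ ≤ K * a / ε ^ 2 + a / ε ^ 2 := by gcongr
        _ = _ := by ring
    have bm : (m : ℝ) ≤ (K + 1 / √c) * (b / ε ^ 2) := by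
      have : 1 ≤ 1 / √c * (b / ε ^ 2) := by
        rw [one_div_mul_eq_div, one_le_div hsc, le_div_iff₀ hε2]
        nlinarith
      calc (m : ℝ) ≤ K * b / ε ^ 2 + 1 := hm'.le
        _ ≤ K * b / ε ^ 2 + 1 / √c * (b / ε ^ 2) := by gcongr
        _ = _ := by ring
    -- The `1` lost to rounding is at most `2 log k`, since `log k ≥ 1/2`.
    have bt : (t : ℝ) ≤ 20 * Real.log k := by linarith
    calc (s : ℝ) + s + k * (t * m)
        ≤ (K + 1) * (a / ε ^ 2) + (K + 1) * (a / ε ^ 2) +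
          k * ((20 * Real.log k) * ((K + 1 / √c) * (b / ε ^ 2))) := by gcongr
      _ = 2 * ((K + 1) * (a / ε ^ 2)) +
          20 * (K + 1 / √c) * ((k * Real.log k) * b / ε ^ 2) := by ring
      _ = _ := by rw [hL, ← haL]; ring
  · calc (3 * 10 ^ 8 : ℝ) ≤ K * √c := hKc
      _ ≤ K * b := by gcongr
      _ ≤ _ := hm
  · calc (3 * 10 ^ 8 * n : ℝ) ≤ K * M := by gcongr
      _ ≤ K * (K * M) := by nlinarith [mul_pos hK0 hM0]
      _ = (K * b) * (K * a) := by rw [← hab]; ring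
      _ ≤ (m * ε ^ 2) * (s * ε ^ 2) := by gcongr
      _ = _ := by ring

theorem theorem3p2 :
    ∀ c : ℝ, 0 < c → ∃ C : ℝ, 0 < C ∧
      ∀ (n k : ℕ) [NeZero n] (ε : ℝ), 2 ≤ k → 0 < ε → ε ≤ 1 →
        ∃ A : Classifier n k,
          (c * (k * Real.log k) ≤ n →
            (A.samples : ℝ) ≤ C * (Real.sqrt (n * k * Real.log k) / ε ^ 2)) ∧
          ((n : ℝ) ≤ c * (k * Real.log k) →
            (A.samples : ℝ) ≤ C * (k * Real.log k / ε ^ 2)) ∧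
          ∀ P : PMF (Fin n), ε ≤ tvDist P (unif n) →
            ∀ χ : Finset (Fin k), 8 / 9 ≤ A.successProb P χ := by
  intro c hc
  have hsc : 0 < √c := Real.sqrt_pos.2 hc
  generalize hB : 22 * (3 * 10 ^ 8 * (1 + 1 / √c)) + 2 + 20 / √c = B
  have hB0 : 0 < B := by rw [← hB]; positivity
  -- For `M = n` the factor `B` suffices; for `M = c L` one has `√(M L) = √c L`, costing `B √c`.
  refine ⟨B * (1 + √c), by positivity, fun n k _ ε hk hε hε1 => ?_⟩
  obtain ⟨A, hA, hsucc⟩ := exists_classifier hc hk hε hε1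
    (le_max_left (n : ℝ) (c * (k * Real.log k))) (le_max_right _ _)
  rw [hB] at hA
  have hL : 0 ≤ (k : ℝ) * Real.log k := by positivity
  refine ⟨A, fun h => ?_, fun h => ?_, hsucc⟩
  · rw [max_eq_left h, ← mul_assoc] at hA
    refine hA.trans ?_
    gcongr
    nlinarith
  · rw [max_eq_right h, mul_assoc, Real.sqrt_mul hc.le, Real.sqrt_mul_self hL] at hA
    refine hA.trans ?_
    have : 0 ≤ (k : ℝ) * Real.log k / ε ^ 2 := by positivity
    calc B * (√c * (k * Real.log k) / ε ^ 2) = B * √c * (k * Real.log k / ε ^ 2) := by ring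
      _ ≤ _ := by gcongr; linarith
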